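/- Let $2\le k\le n-1$, let $S^{n-1}$ be the unit sphere of $\mathbb R^n$ with its surface measure, and let $G_{n,k}$ be the Grassmannian of $k$-dimensional linear subspaces of $\mathbb R^n$ with its $O(n)$-invariant probability measure. Write $S^{n-1}_\pm=\{\theta\in S^{n-1}:\pm\theta_n>0\}$, and for $\xi\in G_{n,k}$ let $d_\xi\theta$ be the $(k-1)$-dimensional surface measure on $S^{n-1}\cap\xi$. For $f\in L^1(S^{n-1})$ (real- or complex-valued) put $$(F_kf)(\xi)=\int_{S^{n-1}\cap\xi}f(\theta)\,d_\xi\theta,\qquad (F_k^{\pm}f)(\xi)=\int_{S^{n-1}_\pm\cap\xi}f(\theta)\,d_\xi\theta .$$ 1. On even functions in $L^1(S^{n-1})$ the transform $F_k$ is injective: if two such functions have transforms that agree for almost every $\xi\in G_{n,k}$, then they agree almost everywhere. Denote by $F_k^{-1}$ the inverse of $F_k$ on even functions in $L^1(S^{n-1})$, i.e. $F_k^{-1}\varphi$ is the (almost everywhere unique) even function $g\in L^1(S^{n-1})$ with $F_kg=\varphi$ almost everywhere on $G_{n,k}$, for every $\varphi$ for which such a $g$ exists. 2. For every $f\in L^1(S^{n-1})$,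 the integrals $(F_k^{\pm}f)(\xi)$ converge absolutely for almost every $\xi\in G_{n,k}$. If $\varphi^{\pm}=F_k^{\pm}f$ almost everywhere on $G_{n,k}$, then $\varphi^+$ and $\varphi^-$ lie in the range of $F_k$ on even functions in $L^1(S^{n-1})$, and $f$ is recovered from $\varphi^{\pm}$ by the formula $$f(\theta)=\begin{cases}2(F_k^{-1}\varphi^+)(\theta) & \text{for almost every }\theta\in S^{n-1}_+,\\ 2(F_k^{-1}\varphi^-)(\theta) & \text{for almost every }\theta\in S^{n-1}_-.\end{cases}$$ -/

import Mathlib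

open MeasureTheory Metric

noncomputable section

namespace HemiFunk

/-- Euclidean space `ℝⁿ`. -/
abbrev E (n : ℕ) : Type := EuclideanSpace ℝ (Fin n)

/-- The unit sphere `S^{n-1}` of `ℝⁿ`. -/
abbrev Sph (n : ℕ) : Type := sphere (0 : E n) 1

/-- Surface measure on the unit sphere of a finite-dimensional Euclidean space `V`, induced by the
Lebesgue measure of `V`. The Lebesgue measure is the one of the inner product on `V`: when `V` is a
proper subspace of `ℝⁿ`, it is not the restriction of the measure of `ℝⁿ`. -/
def surf (V : Type*) [NormedAddCommGroup V] [InnerProductSpace ℝ V] [FiniteDimensional ℝ V]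
    [MeasurableSpace V] [BorelSpace V] : Measure (sphere (0 : V) 1) :=
  (@volume V measureSpaceOfInnerProductSpace).toSphere

/-- The last coordinate `xₙ = ⟨x, eₙ⟩` of `x ∈ ℝⁿ` (with value `0` in the void case `n = 0`). -/
def lastCoord {n : ℕ} (x : E n) : ℝ :=
  if h : 0 < n then x ⟨n - 1, Nat.sub_lt h Nat.one_pos⟩ else 0

/-- The Grassmannian `G_{n,k}` of `k`-dimensional linear subspaces of `ℝⁿ`. -/
def Gr (n k : ℕ) : Type := {ξ : Submodule ℝ (E n) // Module.finrank ℝ ξ = k}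

/-- The orthogonal group `O(n)` of `ℝⁿ`, with the operator norm topology. -/
abbrev Orth (n : ℕ) : Type := unitary (E n →L[ℝ] E n)

instance (n : ℕ) : ContinuousStar (E n →L[ℝ] E n) :=
  ⟨(ContinuousLinearMap.adjoint (𝕜 := ℝ) (E := E n) (F := E n)).continuous⟩

instance (n : ℕ) : ContinuousMul (E n →L[ℝ] E n) :=
  ⟨continuous_fst.clm_comp continuous_snd⟩

instance (n : ℕ) : CompactSpace (Orth n) := by
  have : ProperSpace (E n →L[ℝ] E n) := FiniteDimensional.proper ℝ _
  refine isCompact_iff_compactSpace.mp (Metric.isCompact_of_isClosed_isBounded isClosed_unitary ?_)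
  refine (isBounded_iff_forall_norm_le).2 ⟨1, fun u hu => ?_⟩
  refine ContinuousLinearMap.opNorm_le_bound _ zero_le_one fun x => ?_
  have h := (Unitary.linearIsometryEquiv (⟨u, hu⟩ : Orth n)).norm_map x
  rw [one_mul]
  exact h.le

/-- The action of `O(n)` on subspaces, `ξ ↦ γ ξ`. -/
def rotate {n k : ℕ} (γ : Orth n) (ξ : Gr n k) : Gr n k :=
  ⟨ξ.1.map (Unitary.linearIsometryEquiv γ).toLinearEquiv.toLinearMap,
    ((Unitary.linearIsometryEquiv γ).toLinearEquiv.finrank_map_eq ξ.1).trans ξ.2⟩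

/-- The σ-algebra of the homogeneous space `G_{n,k} = O(n) / (O(k) × O(n-k))`: a set of subspaces
is measurable if its preimages in `O(n)` under the orbit maps `γ ↦ γ ξ₀` are Borel. -/
instance (n k : ℕ) : MeasurableSpace (Gr n k) :=
  ⨅ ξ₀ : Gr n k, MeasurableSpace.map (fun γ : Orth n => rotate γ ξ₀) inferInstance

theorem measurable_rotate {n k : ℕ} (ξ₀ : Gr n k) :
    Measurable (fun γ : Orth n => rotate γ ξ₀) :=
  measurable_iff_le_map.2 (iInf_le _ ξ₀)

/-- The coordinate subspace `span (e₁, …, e_k)`, as base point of `G_{n,k}`. -/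
def coordSubspace {n k : ℕ} (hkn : k ≤ n) : Gr n k :=
  ⟨Submodule.span ℝ (Set.range fun i : Fin k => EuclideanSpace.basisFun (Fin n) ℝ (Fin.castLE hkn i)),
    by
      have h := (EuclideanSpace.basisFun (Fin n) ℝ).orthonormal.linearIndependent.comp
        (Fin.castLE hkn) (Fin.castLE_injective hkn)
      exact (finrank_span_eq_card h).trans (Fintype.card_fin k)⟩

/-- The `O(n)`-invariant probability measure on `G_{n,k}`: the law of `γ ξ₀` for a Haar distributed
`γ ∈ O(n)`. -/
def grMeasure {n k : ℕ} (hkn : k ≤ n) : Measure (Gr n k) :=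
  Measure.map (fun γ : Orth n => rotate γ (coordSubspace hkn)) (Measure.haarMeasure ⊤)

/-- The unit sphere of a subspace `ξ`, i.e. `S^{n-1} ∩ ξ`, included into `S^{n-1}`. -/
def incl {n : ℕ} (ξ : Submodule ℝ (E n)) (θ : sphere (0 : ξ) 1) : Sph n :=
  ⟨((θ : ξ) : E n), by
    have h : ‖(θ : ξ)‖ = 1 := mem_sphere_zero_iff_norm.1 θ.2
    exact mem_sphere_zero_iff_norm.2 h⟩

variable {𝕜 : Type*} [RCLike 𝕜] {n k : ℕ}

/-- The Funk-type transform `(F_k f)(ξ) = ∫_{S^{n-1} ∩ ξ} f(θ) d_ξ θ`. -/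
def funk (f : Sph n → 𝕜) (ξ : Gr n k) : 𝕜 :=
  ∫ θ, f (incl ξ.1 θ) ∂surf ξ.1

/-- The open hemisphere `S^{n-1}_+ ∩ ξ` of the unit sphere of `ξ`. -/
def upper (ξ : Gr n k) : Set (sphere (0 : ξ.1) 1) := {θ | 0 < lastCoord (incl ξ.1 θ : E n)}

/-- The open hemisphere `S^{n-1}_- ∩ ξ` of the unit sphere of `ξ`. -/
def lower (ξ : Gr n k) : Set (sphere (0 : ξ.1) 1) := {θ | lastCoord (incl ξ.1 θ : E n) < 0}

/-- The transform `(F_k^+ f)(ξ) = ∫_{S^{n-1}_+ ∩ ξ} f(θ) d_ξ θ`. -/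
def funkPlus (f : Sph n → 𝕜) (ξ : Gr n k) : 𝕜 :=
  ∫ θ in upper ξ, f (incl ξ.1 θ) ∂surf ξ.1

/-- The transform `(F_k^- f)(ξ) = ∫_{S^{n-1}_- ∩ ξ} f(θ) d_ξ θ`. -/
def funkMinus (f : Sph n → 𝕜) (ξ : Gr n k) : 𝕜 :=
  ∫ θ in lower ξ, f (incl ξ.1 θ) ∂surf ξ.1

/-- `g` is an even function in `L¹(S^{n-1})`, where evenness is meant almost everywhere. -/
def EvenL1 (g : Sph n → 𝕜) : Prop :=
  Integrable g (surf (E n)) ∧ ∀ᵐ θ ∂surf (E n), g (-θ) = g θ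

/-- `g` is an even integrable function with `F_k g = φ` almost everywhere on `G_{n,k}`. -/
def IsFunkPreimage (hkn : k ≤ n) (φ : Gr n k → 𝕜) (g : Sph n → 𝕜) : Prop :=
  EvenL1 g ∧ ∀ᵐ ξ ∂grMeasure hkn, funk g ξ = φ ξ

open Classical in
/-- The inverse `F_k⁻¹` of the transform `F_k` on even integrable functions: if `φ` lies in the
range of `F_k` on such functions, then `F_k⁻¹ φ` is a representative of the even integrable function
with transform `φ`. (Outside the range it has the value `0`.) -/
def funkInv (hkn : k ≤ n) (φ : Gr n k → 𝕜) : Sph n → 𝕜 :=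
  if h : ∃ g, IsFunkPreimage hkn φ g then h.choose else 0

end HemiFunk

end

/-! Recovery reduces to injectivity. Let g be half the sum of the restriction of f to an open
hemisphere and the reflection of that restriction. Surface measure on each S^{n-1} ∩ ξ is symmetric,
so F_k g is the hemispherical transform of f, while 2g = f on the hemisphere. Thus g is an even
preimage, and injectivity identifies it with `funkInv`.

For injectivity, let h be real, even, with F_k h = 0 almost everywhere. Fix ξ, a unit vector ω in ξ
and a unit vector a, and let γ be Haar distributed in O(n), so that γω is uniform on the sphere. The
weight ‖P_{γξ} a‖^{2m} depends only on γξ, hence ∫ h(γω) ‖P_{γξ} a‖^{2m} dγ = 0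
(`integral_act_mul_eq_zero`). Averaging over the stabilizer of ω turns the weight into a polynomial
of degree m in ⟨a, γω⟩² (`integral_stab_norm_starProjection`); its leading coefficient is nonzero
because ξ is a proper subspace. Induction on m kills every even moment of h
(`integral_act_mul_inner_pow_eq_zero`), and evenness kills the odd ones. A function on the sphere
with vanishing moments has vanishing Fourier transform, so it is zero
(`ae_eq_zero_of_forall_moment_eq_zero`). -/

noncomputable section

namespace HemiFunk

open scoped ENNReal Pointwise

variable {n k : ℕ}

/-! ### Haar measure on compact groups -/

section CompactGroup

variable {G : Type*} [Group G] [TopologicalSpace G] [IsTopologicalGroup G] [CompactSpace G]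
  [MeasurableSpace G] [BorelSpace G]

instance : IsProbabilityMeasure (Measure.haarMeasure (⊤ : TopologicalSpace.PositiveCompacts G)) :=
  ⟨by simpa using Measure.haarMeasure_self (K₀ := (⊤ : TopologicalSpace.PositiveCompacts G))⟩

/-- Haar measure on a compact group is right invariant. -/
instance : (Measure.haarMeasure (⊤ : TopologicalSpace.PositiveCompacts G)).IsMulRightInvariant where
  map_mul_right_eq_self g := by
    have : IsProbabilityMeasure
        (Measure.map (· * g) (Measure.haarMeasure (⊤ : TopologicalSpace.PositiveCompacts G))) :=
      Measure.isProbabilityMeasure_map (measurable_mul_const g).aemeasurable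
    -- A right translate of Haar measure is again a Haar probability measure, and there is only one.
    exact Measure.isHaarMeasure_eq_of_isProbabilityMeasure _ _

end CompactGroup

/-! ### Surface measure and isometries -/

section Sphere

variable {V W : Type*} [NormedAddCommGroup V] [InnerProductSpace ℝ V] [NormedAddCommGroup W]
  [InnerProductSpace ℝ W]

/-- The map of unit spheres induced by a linear isometry. -/
def sphereMap (L : V ≃ₗᵢ[ℝ] W) (θ : sphere (0 : V) 1) : sphere (0 : W) 1 :=
  ⟨L θ, by simp⟩

@[simp]
theorem coe_sphereMap (L : V ≃ₗᵢ[ℝ] W) (θ : sphere (0 : V) 1) : (sphereMap L θ : W) = L θ := rfl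

theorem continuous_sphereMap (L : V ≃ₗᵢ[ℝ] W) : Continuous (sphereMap L) :=
  (L.continuous.comp continuous_subtype_val).subtype_mk _

variable [FiniteDimensional ℝ V] [MeasurableSpace V] [BorelSpace V]
  [FiniteDimensional ℝ W] [MeasurableSpace W] [BorelSpace W]

instance : IsFiniteMeasure (surf V) := by
  unfold surf; infer_instance

theorem surf_ne_zero [Nontrivial V] : surf V ≠ 0 := by
  unfold surf; exact Measure.toSphere_ne_zero _

/-- Surface measure is transported by linear isometries. -/
theorem measurePreserving_sphereMap (L : V ≃ₗᵢ[ℝ] W) :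
    MeasurePreserving (sphereMap L) (surf V) (surf W) := by
  have hm := (continuous_sphereMap L).measurable
  refine ⟨hm, Measure.ext fun s hs => ?_⟩
  have hL := @LinearIsometryEquiv.measurePreserving _ _ _ _ _ _ _ _ _ _ _ _ L.symm
  rw [Measure.map_apply hm hs, surf, surf, Measure.toSphere_apply' _ hs,
    Measure.toSphere_apply' _ (hm hs), L.toLinearEquiv.finrank_eq]
  congr 1
  -- `toSphere` gives s the dimension times the volume of the cone over s; L carries cones to cones
  -- and preserves volume.
  have hset : (Set.Ioo (0 : ℝ) 1 • ((↑) '' s : Set W)) =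
      L.symm ⁻¹' (Set.Ioo (0 : ℝ) 1 • ((↑) '' (sphereMap L ⁻¹' s) : Set V)) := by
    ext x
    simp only [Set.mem_smul, Set.mem_image, Set.mem_preimage]
    constructor
    · rintro ⟨c, hc, _, ⟨y, hy, rfl⟩, rfl⟩
      refine ⟨c, hc, L.symm y, ⟨⟨L.symm y, by simp⟩, ?_, rfl⟩, by simp⟩
      have : sphereMap L ⟨L.symm y, by simp⟩ = y := Subtype.ext (by simp)
      rwa [this]
    · rintro ⟨c, hc, _, ⟨y, hy, rfl⟩, hxy⟩
      refine ⟨c, hc, L y, ⟨sphereMap L y, hy, rfl⟩, ?_⟩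
      rw [← map_smul, hxy, L.apply_symm_apply]
  rw [hset]
  exact (hL.measure_preimage_emb L.symm.toHomeomorph.measurableEmbedding _).symm

theorem measurePreserving_neg : MeasurePreserving (fun θ => -θ) (surf V) (surf V) := by
  have h : (fun θ : sphere (0 : V) 1 => -θ) = sphereMap (LinearIsometryEquiv.neg ℝ) := by
    ext θ; rfl
  rw [h]
  exact measurePreserving_sphereMap _

end Sphere

/-! ### Orthogonal group acting on the sphere -/

/-- The action of `O(n)` on the unit sphere. -/
def act (γ : Orth n) (θ : Sph n) : Sph n := sphereMap (Unitary.linearIsometryEquiv γ) θ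

theorem act_mul (γ δ : Orth n) (θ : Sph n) : act (γ * δ) θ = act γ (act δ θ) := rfl

theorem continuous_act : Continuous fun p : Orth n × Sph n => act p.1 p.2 :=
  ((continuous_subtype_val.comp continuous_fst).clm_apply
    (continuous_subtype_val.comp continuous_snd)).subtype_mk _

theorem measurePreserving_act (γ : Orth n) :
    MeasurePreserving (act γ) (surf (E n)) (surf (E n)) :=
  measurePreserving_sphereMap _

/-- The orthogonal map exchanging two vectors `v` and `w` of the same length. -/
def swap (v w : E n) : Orth n :=
  Unitary.linearIsometryEquiv.symm ((ℝ ∙ (v - w))ᗮ.reflection)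

theorem swap_apply (v w x : E n) :
    (swap v w : E n →L[ℝ] E n) x = (ℝ ∙ (v - w))ᗮ.reflection x := rfl

theorem swap_apply_left {v w : E n} (h : ‖v‖ = ‖w‖) : (swap v w : E n →L[ℝ] E n) v = w :=
  Submodule.reflection_sub h

theorem swap_apply_of_inner_eq_zero {v w x : E n} (h : inner ℝ (v - w) x = 0) :
    (swap v w : E n →L[ℝ] E n) x = x := by
  rw [swap_apply, Submodule.reflection_eq_self_iff]
  exact Submodule.mem_orthogonal_singleton_iff_inner_right.2 h

/-- The reflection moves each vector by a multiple of v - w, which lies in ξ. Hence the stabilizer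
of ξ is transitive on S^{n-1} ∩ ξ. -/
theorem rotate_swap {v w : E n} (ξ : Gr n k) (hv : v ∈ ξ.1) (hw : w ∈ ξ.1) :
    rotate (swap v w) ξ = ξ := by
  refine Subtype.ext (Submodule.eq_of_le_of_finrank_eq ?_
    ((rotate (swap v w) ξ).2.trans ξ.2.symm))
  rintro _ ⟨x, hx, rfl⟩
  change (swap v w : E n →L[ℝ] E n) x ∈ ξ.1
  rw [swap_apply, Submodule.reflection_orthogonal_apply, Submodule.reflection_singleton_apply]
  refine ξ.1.neg_mem (ξ.1.sub_mem ?_ hx)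
  exact nsmul_mem (ξ.1.smul_mem _ (ξ.1.sub_mem hv hw)) 2

theorem act_swap (θ ω : Sph n) : act (swap (θ : E n) ω) θ = ω :=
  Subtype.ext (swap_apply_left (by simp))

theorem continuous_incl (ξ : Submodule ℝ (E n)) : Continuous (incl ξ) :=
  (continuous_subtype_val.comp continuous_subtype_val).subtype_mk _

/-- Normalized Haar measure on `O(n)`. -/
abbrev orthHaar (n : ℕ) : Measure (Orth n) := Measure.haarMeasure ⊤

theorem measurable_act : Measurable fun p : Orth n × Sph n => act p.1 p.2 :=
  continuous_act.measurable

theorem measurable_act_left (θ : Sph n) : Measurable fun γ : Orth n => act γ θ :=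
  (continuous_act.comp (Continuous.prodMk_left θ)).measurable

theorem orthHaar_preimage_act (θ ω : Sph n) (s : Set (Sph n)) :
    orthHaar n ((fun γ => act γ θ) ⁻¹' s) = orthHaar n ((fun γ => act γ ω) ⁻¹' s) := by
  have h : (fun γ => act γ θ) ⁻¹' s =
      (fun γ => γ * swap (ω : E n) θ) ⁻¹' ((fun γ => act γ ω) ⁻¹' s) := by
    ext γ
    simp only [Set.mem_preimage, act_mul, act_swap]
  rw [h]
  exact measure_preimage_mul_right (orthHaar n) (swap (ω : E n) θ) _

/-- A random rotation carries each point to a uniformly distributed point. -/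
theorem map_act_orthHaar (ω : Sph n) :
    surf (E n) Set.univ • Measure.map (fun γ => act γ ω) (orthHaar n) = surf (E n) := by
  refine Measure.ext fun s hs => ?_
  -- Compute the product measure of {(γ, θ) : γθ ∈ s} by slicing both ways: the γ-slices have the
  -- surface measure of s, and the θ-slices have Haar measure independent of θ.
  have hs' := measurable_act hs
  have h1 := Measure.prod_apply (μ := orthHaar n) (ν := surf (E n)) hs'
  have h2 := Measure.prod_apply_symm (μ := orthHaar n) (ν := surf (E n)) hs'
  have h3 : ∀ γ : Orth n, surf (E n) (Prod.mk γ ⁻¹' ((fun p : Orth n × Sph n => act p.1 p.2) ⁻¹' s))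
      = surf (E n) s := fun γ => (measurePreserving_act γ).measure_preimage hs.nullMeasurableSet
  have h4 : ∀ θ : Sph n, orthHaar n ((fun γ => (γ, θ)) ⁻¹'
      ((fun p : Orth n × Sph n => act p.1 p.2) ⁻¹' s)) = orthHaar n ((fun γ => act γ ω) ⁻¹' s) :=
    fun θ => orthHaar_preimage_act θ ω s
  rw [lintegral_congr h3, lintegral_const, measure_univ, mul_one] at h1
  rw [lintegral_congr h4, lintegral_const] at h2
  rw [Measure.smul_apply, Measure.map_apply (measurable_act_left ω) hs, smul_eq_mul, mul_comm,
    ← h2, h1]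

section Sphere

variable {V W : Type*} [NormedAddCommGroup V] [InnerProductSpace ℝ V] [NormedAddCommGroup W]
  [InnerProductSpace ℝ W] [FiniteDimensional ℝ V] [MeasurableSpace V] [BorelSpace V]
  [MeasurableSpace W] [BorelSpace W]

/-- With an embedding, the changes of variables below hold for arbitrary integrands, measurable or
not. -/
theorem measurableEmbedding_sphereMap (L : V ≃ₗᵢ[ℝ] W) : MeasurableEmbedding (sphereMap L) := by
  have : ProperSpace V := FiniteDimensional.proper ℝ V
  refine ((continuous_sphereMap L).isClosedEmbedding fun θ ω h => ?_).measurableEmbedding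
  exact Subtype.ext (L.injective (congrArg Subtype.val h))

end Sphere

theorem integral_rotate {F : Type*} [NormedAddCommGroup F] [NormedSpace ℝ F]
    (f : Sph n → F) (γ : Orth n) (ξ : Gr n k) :
    ∫ θ, f (incl (rotate γ ξ).1 θ) ∂surf (rotate γ ξ).1 =
      ∫ θ, f (act γ (incl ξ.1 θ)) ∂surf ξ.1 :=
  ((measurePreserving_sphereMap
    ((Unitary.linearIsometryEquiv γ).submoduleMap ξ.1)).integral_comp
      (measurableEmbedding_sphereMap _) _).symm

theorem lintegral_rotate (u : Sph n → ℝ≥0∞) (γ : Orth n) (ξ : Gr n k) :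
    ∫⁻ θ, u (incl (rotate γ ξ).1 θ) ∂surf (rotate γ ξ).1 =
      ∫⁻ θ, u (act γ (incl ξ.1 θ)) ∂surf ξ.1 :=
  ((measurePreserving_sphereMap
    ((Unitary.linearIsometryEquiv γ).submoduleMap ξ.1)).lintegral_comp_emb
      (measurableEmbedding_sphereMap _) _).symm

theorem measurable_act_incl (ξ : Submodule ℝ (E n)) :
    Measurable fun p : Orth n × sphere (0 : ξ) 1 => act p.1 (incl ξ p.2) :=
  (continuous_act.comp (continuous_fst.prodMk
    ((continuous_incl ξ).comp continuous_snd))).measurable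

/-- If `γ` is Haar distributed and `θ` is distributed over `S^{n-1} ∩ ξ`, then `γ θ` is uniformly
distributed over `S^{n-1}`. -/
theorem map_act_incl (ξ : Submodule ℝ (E n)) :
    surf (E n) Set.univ • Measure.map (fun p : Orth n × sphere (0 : ξ) 1 => act p.1 (incl ξ p.2))
      ((orthHaar n).prod (surf ξ)) = surf ξ Set.univ • surf (E n) := by
  refine Measure.ext fun s hs => ?_
  have h1 : ∀ θ : sphere (0 : ξ) 1, orthHaar n ((fun γ => (γ, θ)) ⁻¹'
      ((fun p : Orth n × sphere (0 : ξ) 1 => act p.1 (incl ξ p.2)) ⁻¹' s)) *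
        surf (E n) Set.univ = surf (E n) s := fun θ => by
    conv_rhs => rw [← map_act_orthHaar (incl ξ θ), Measure.smul_apply,
      Measure.map_apply (measurable_act_left _) hs, smul_eq_mul, mul_comm]
    rfl
  rw [Measure.smul_apply, Measure.smul_apply, Measure.map_apply (measurable_act_incl ξ) hs,
    Measure.prod_apply_symm (measurable_act_incl ξ hs), smul_eq_mul, smul_eq_mul, mul_comm,
    ← lintegral_mul_const' _ _ (measure_ne_top _ _), lintegral_congr h1, lintegral_const, mul_comm]

/-! ### Integration over the Grassmannian -/

theorem measurable_gr {α : Type*} [MeasurableSpace α] {F : Gr n k → α}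
    (h : ∀ ξ, Measurable fun γ : Orth n => F (rotate γ ξ)) : Measurable F := by
  intro s hs
  exact MeasurableSpace.measurableSet_iInf.2 fun ξ => h ξ hs

theorem measurable_lintegral_incl {u : Sph n → ℝ≥0∞} (hu : Measurable u) :
    Measurable fun ξ : Gr n k => ∫⁻ θ, u (incl ξ.1 θ) ∂surf ξ.1 := by
  refine measurable_gr fun ξ => ?_
  simp_rw [lintegral_rotate]
  exact (hu.comp (measurable_act_incl ξ.1)).lintegral_prod_right'

/-- Tonelli on O(n) × (S^{n-1} ∩ ξ₀), combined with the uniform distribution of γθ. Keeping the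
total masses on both sides avoids dividing in `ℝ≥0∞`. -/
theorem lintegral_grMeasure (hkn : k ≤ n) {u : Sph n → ℝ≥0∞} (hu : Measurable u) :
    surf (E n) Set.univ * ∫⁻ ξ, ∫⁻ θ, u (incl ξ.1 θ) ∂surf ξ.1 ∂grMeasure hkn =
      surf (coordSubspace (n := n) hkn).1 Set.univ * ∫⁻ θ, u θ ∂surf (E n) := by
  rw [grMeasure, lintegral_map (measurable_lintegral_incl hu) (measurable_rotate _)]
  simp_rw [lintegral_rotate]
  have h := lintegral_prod (μ := orthHaar n) (ν := surf (coordSubspace (n := n) hkn).1) _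
    (hu.comp (measurable_act_incl (coordSubspace (n := n) hkn).1)).aemeasurable
  have h' := congrArg (fun m => ∫⁻ θ, u θ ∂m) (map_act_incl (coordSubspace (n := n) hkn).1)
  simp only [lintegral_smul_measure, smul_eq_mul] at h'
  rw [lintegral_map hu (measurable_act_incl _)] at h'
  rw [← h']
  exact congrArg _ h.symm

/-- A subsphere may be null in S^{n-1}, so f cannot simply be replaced by a measurable
representative. `lintegral_grMeasure` is applied both to the norm of the representative and to a
null set N containing all points of disagreement: almost every ξ meets N in a null subset of its own
sphere. -/
theorem ae_integrable_incl [NeZero n] (hkn : k ≤ n) {F : Type*} [NormedAddCommGroup F]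
    {f : Sph n → F} (hf : Integrable f (surf (E n))) :
    ∀ᵐ ξ ∂grMeasure hkn, Integrable (fun θ => f (incl ξ.1 θ)) (surf ξ.1) := by
  have hσ : surf (E n) Set.univ ≠ 0 := by
    simpa using surf_ne_zero (V := E n)
  obtain ⟨g, hg, hfg⟩ := hf.1
  obtain ⟨N, hN, hNm, hN0⟩ := exists_measurable_superset_of_null hfg
  have h1 : ∀ᵐ ξ ∂grMeasure hkn,
      ∫⁻ θ, N.indicator (fun _ => (1 : ℝ≥0∞)) (incl ξ.1 θ) ∂surf ξ.1 = 0 := by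
    have hm : Measurable (N.indicator fun _ => (1 : ℝ≥0∞)) := measurable_const.indicator hNm
    have h := lintegral_grMeasure hkn hm
    rw [lintegral_indicator_const hNm, hN0, mul_zero, mul_zero, mul_eq_zero] at h
    exact (lintegral_eq_zero_iff (measurable_lintegral_incl hm)).1 (h.resolve_left hσ)
  have h2 : ∀ᵐ ξ ∂grMeasure hkn, ∫⁻ θ, ‖g (incl ξ.1 θ)‖ₑ ∂surf ξ.1 < ∞ := by
    have hm : Measurable fun θ => ‖g θ‖ₑ := hg.enorm
    have h := lintegral_grMeasure hkn hm
    have hfin : ∫⁻ θ, ‖g θ‖ₑ ∂surf (E n) < ∞ := (hf.congr hfg).2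
    refine ae_lt_top (measurable_lintegral_incl hm) fun htop => ?_
    rw [htop, ENNReal.mul_top hσ] at h
    exact (ENNReal.mul_lt_top (measure_lt_top _ _) hfin).ne h.symm
  filter_upwards [h1, h2] with ξ h1 h2
  refine Integrable.congr (f := fun θ => g (incl ξ.1 θ))
    ⟨(hg.comp_measurable (continuous_incl ξ.1).measurable).aestronglyMeasurable, h2⟩ ?_
  have h1 := (lintegral_eq_zero_iff
    ((measurable_const.indicator hNm).comp (continuous_incl ξ.1).measurable)).1 h1
  filter_upwards [h1] with θ hθ
  by_contra hne
  have : incl ξ.1 θ ∈ N := hN fun h => hne h.symm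
  simp [this] at hθ

theorem integrable_act_incl [NeZero n] {F : Type*} [NormedAddCommGroup F]
    {f : Sph n → F} (hf : Integrable f (surf (E n))) (ξ : Submodule ℝ (E n)) :
    Integrable (fun p : Orth n × sphere (0 : ξ) 1 => f (act p.1 (incl ξ p.2)))
      ((orthHaar n).prod (surf ξ)) := by
  have h := hf.smul_measure (c := surf ξ Set.univ) (measure_ne_top _ _)
  rw [← map_act_incl, integrable_smul_measure
    (by simpa using surf_ne_zero (V := E n)) (measure_ne_top _ _)] at h
  exact h.comp_measurable (measurable_act_incl ξ)

theorem integrable_act [NeZero n] {F : Type*} [NormedAddCommGroup F]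
    {f : Sph n → F} (hf : Integrable f (surf (E n))) (ω : Sph n) :
    Integrable (fun γ => f (act γ ω)) (orthHaar n) := by
  rw [← map_act_orthHaar ω, integrable_smul_measure
    (by simpa using surf_ne_zero (V := E n)) (measure_ne_top _ _)] at hf
  exact hf.comp_measurable (measurable_act_left ω)

theorem integral_act [NeZero n] {f : Sph n → ℝ} (hf : AEStronglyMeasurable f (surf (E n)))
    (ω : Sph n) :
    ∫ θ, f θ ∂surf (E n) = (surf (E n)).real Set.univ * ∫ γ, f (act γ ω) ∂orthHaar n := by
  have hac : Measure.map (fun γ => act γ ω) (orthHaar n) ≪ surf (E n) := by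
    conv_rhs => rw [← map_act_orthHaar ω]
    exact Measure.absolutelyContinuous_smul (by simpa using surf_ne_zero (V := E n))
  rw [← integral_map (measurable_act_left ω).aemeasurable (hf.mono_ac hac)]
  conv_lhs => rw [← map_act_orthHaar ω]
  rw [integral_smul_measure]
  rfl

theorem integrable_act_mul [NeZero n] {h : Sph n → ℝ} (hh : Integrable h (surf (E n))) (ω : Sph n)
    {Ψ : Orth n → ℝ} (hΨ : Continuous Ψ) :
    Integrable (fun γ => h (act γ ω) * Ψ γ) (orthHaar n) := by
  obtain ⟨C, hC⟩ := (isCompact_range hΨ).isBounded.exists_norm_le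
  exact (integrable_act hh ω).mul_bdd hΨ.aestronglyMeasurable (ae_of_all _ fun γ => hC _ ⟨γ, rfl⟩)

/-! ### Duality on the orthogonal group -/

/-- Duality: if the transform of `h` vanishes, then `h` annihilates the functions on `O(n)` that are
invariant under right translation by the stabilizer of `ξ`. -/
theorem integral_act_mul_eq_zero [NeZero n] {h : Sph n → ℝ} (hh : Integrable h (surf (E n)))
    (ξ : Gr n k) (hk : 0 < k)
    (h0 : ∀ᵐ γ ∂orthHaar n, ∫ θ, h (act γ (incl ξ.1 θ)) ∂surf ξ.1 = 0)
    {Ψ : Orth n → ℝ} (hΨ : Continuous Ψ)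
    (hinv : ∀ γ r : Orth n, rotate r ξ = ξ → Ψ (γ * r) = Ψ γ) (ω : sphere (0 : ξ.1) 1) :
    ∫ γ, h (act γ (incl ξ.1 ω)) * Ψ γ ∂orthHaar n = 0 := by
  obtain ⟨C, hC⟩ := (isCompact_range hΨ).isBounded.exists_norm_le
  have hC' : ∀ γ, ‖Ψ γ‖ ≤ C := fun γ => hC _ ⟨γ, rfl⟩
  have hint : Integrable (fun p : Orth n × sphere (0 : ξ.1) 1 => h (act p.1 (incl ξ.1 p.2)) * Ψ p.1)
      ((orthHaar n).prod (surf ξ.1)) :=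
    (integrable_act_incl hh ξ.1).mul_bdd
      (hΨ.comp continuous_fst).aestronglyMeasurable (ae_of_all _ fun p => hC' p.1)
  -- Right translation by a reflection that preserves ξ and takes ω to θ leaves Ψ unchanged. The
  -- integral is therefore constant in θ, and integrating over θ brings in the vanishing transform.
  have hconst : ∀ θ : sphere (0 : ξ.1) 1, ∫ γ, h (act γ (incl ξ.1 θ)) * Ψ γ ∂orthHaar n =
      ∫ γ, h (act γ (incl ξ.1 ω)) * Ψ γ ∂orthHaar n := fun θ => by
    rw [← integral_mul_right_eq_self (fun γ => h (act γ (incl ξ.1 ω)) * Ψ γ)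
      (swap (incl ξ.1 ω : E n) (incl ξ.1 θ))]
    refine integral_congr_ae (ae_of_all _ fun γ => ?_)
    have hr := hinv γ (swap (incl ξ.1 ω : E n) (incl ξ.1 θ))
      (rotate_swap ξ (ω : ξ.1).2 (θ : ξ.1).2)
    have ha : act (γ * swap (incl ξ.1 ω : E n) (incl ξ.1 θ)) (incl ξ.1 ω) = act γ (incl ξ.1 θ) := by
      rw [act_mul, act_swap]
    exact congrArg₂ (· * ·) (congrArg h ha.symm) hr.symm
  have h1 := integral_integral_swap (f := fun γ θ => h (act γ (incl ξ.1 θ)) * Ψ γ) hint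
  have h2 : ∫ γ, ∫ θ, h (act γ (incl ξ.1 θ)) * Ψ γ ∂surf ξ.1 ∂orthHaar n = 0 := by
    refine integral_eq_zero_of_ae ?_
    filter_upwards [h0] with γ hγ
    rw [integral_mul_const, hγ, zero_mul]; rfl
  have h3 := h1.symm.trans h2
  rw [integral_congr_ae (ae_of_all _ hconst), integral_const, smul_eq_mul] at h3
  refine (mul_eq_zero.1 h3).resolve_left ?_
  have : Nontrivial ξ.1 := Module.nontrivial_of_finrank_pos (R := ℝ) (by rw [ξ.2]; exact hk)
  exact ENNReal.toReal_ne_zero.2 ⟨by simpa using surf_ne_zero (V := ξ.1), measure_ne_top _ _⟩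

/-! ### Averaging over the stabilizer of a vector -/

/-- The stabilizer of a vector in the orthogonal group. -/
def stab (ω : E n) : Subgroup (Orth n) where
  carrier := {r | (r : E n →L[ℝ] E n) ω = ω}
  one_mem' := rfl
  mul_mem' {r s} hr hs := (congrArg (r : E n →L[ℝ] E n) hs).trans hr
  inv_mem' {r} hr := by
    have h : ((r⁻¹ * r : Orth n) : E n →L[ℝ] E n) ω = ω := by rw [inv_mul_cancel]; rfl
    exact (congrArg ((r⁻¹ : Orth n) : E n →L[ℝ] E n) hr).symm.trans h

theorem mem_stab {ω : E n} {r : Orth n} : r ∈ stab ω ↔ (r : E n →L[ℝ] E n) ω = ω := Iff.rfl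

instance (ω : E n) : CompactSpace (stab ω) := by
  refine isCompact_iff_compactSpace.1 (IsClosed.isCompact (s := {r : Orth n | _}) ?_)
  exact isClosed_eq (continuous_subtype_val.clm_apply continuous_const) continuous_const

/-- Normalized Haar measure on the stabilizer of a vector. -/
abbrev stabHaar (ω : E n) : Measure (stab ω) := Measure.haarMeasure ⊤

theorem inv_apply_self (r : Orth n) (x : E n) :
    ((r⁻¹ : Orth n) : E n →L[ℝ] E n) ((r : E n →L[ℝ] E n) x) = x := by
  change ((r⁻¹ * r : Orth n) : E n →L[ℝ] E n) x = x
  rw [inv_mul_cancel]; rfl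

theorem inner_apply_apply (r : Orth n) (x y : E n) :
    inner ℝ ((r : E n →L[ℝ] E n) x) ((r : E n →L[ℝ] E n) y) = inner ℝ x y :=
  (Unitary.linearIsometryEquiv r).inner_map_map x y

theorem norm_apply (r : Orth n) (x : E n) : ‖(r : E n →L[ℝ] E n) x‖ = ‖x‖ :=
  (Unitary.linearIsometryEquiv r).norm_map x

theorem inner_inv_apply (r : Orth n) (x y : E n) :
    inner ℝ (((r⁻¹ : Orth n) : E n →L[ℝ] E n) x) y = inner ℝ x ((r : E n →L[ℝ] E n) y) := by
  rw [← inner_apply_apply r⁻¹ x, inv_apply_self]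

/-- The projection onto rξ is r P_ξ r⁻¹. This makes ‖P_ξ γ⁻¹ a‖ an admissible weight in
`integral_act_mul_eq_zero`. -/
theorem norm_starProjection_inv_apply {ξ : Gr n k} {r : Orth n} (hr : rotate r ξ = ξ) (x : E n) :
    ‖ξ.1.starProjection (((r⁻¹ : Orth n) : E n →L[ℝ] E n) x)‖ = ‖ξ.1.starProjection x‖ := by
  have h := Submodule.starProjection_map_apply (Unitary.linearIsometryEquiv r) ξ.1 x
  have hr' : ξ.1.map ((Unitary.linearIsometryEquiv r).toLinearEquiv : E n →ₗ[ℝ] E n) = ξ.1 :=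
    congrArg Subtype.val hr
  have h2 : (ξ.1.map ((Unitary.linearIsometryEquiv r).toLinearEquiv : E n →ₗ[ℝ] E n)).starProjection x
      = ξ.1.starProjection x := by
    simp only [hr']
  rw [← h2]
  refine Eq.trans ?_ (congrArg norm h).symm
  rw [LinearIsometryEquiv.norm_map]
  rfl

/-- The average of `x ↦ ‖P_ξ x‖^(2m)` over the stabilizer of a unit vector `ω ∈ ξ`, in terms of
the coordinate `⟨x, ω⟩`. -/
theorem integral_stab_norm_starProjection (ξ : Gr n k) {ω : E n} (hω : ω ∈ ξ.1) (hω1 : ‖ω‖ = 1)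
    {v : E n} (hv : v ∈ ξ.1ᗮ) (hv1 : ‖v‖ = 1) {x : E n} (hx : ‖x‖ = 1) (m : ℕ) :
    ∫ r : stab ω, (‖ξ.1.starProjection (((r : Orth n)⁻¹ : Orth n).1 x)‖ ^ 2) ^ m
      ∂stabHaar ω =
    ∫ r : stab ω, (inner ℝ x ω ^ 2 + (1 - inner ℝ x ω ^ 2) *
      ‖ξ.1.starProjection (((r : Orth n)⁻¹ : Orth n).1 v)‖ ^ 2) ^ m
      ∂stabHaar ω := by
  set t := inner ℝ x ω with ht
  set y := x - t • ω with hy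
  have hωω : inner ℝ ω ω = 1 := by rw [real_inner_self_eq_norm_sq, hω1, one_pow]
  have hvω : inner ℝ v ω = 0 := Submodule.inner_left_of_mem_orthogonal hω hv
  have hyω : inner ℝ y ω = 0 := by
    rw [hy, inner_sub_left, inner_smul_left, hωω, ← ht]; simp
  have hxy : x = t • ω + y := by rw [hy]; abel
  have hyn : ‖y‖ ^ 2 = 1 - t ^ 2 := by
    have h : ‖x‖ ^ 2 = t ^ 2 + ‖y‖ ^ 2 := by
      conv_lhs => rw [hxy]
      rw [norm_add_sq_real, inner_smul_left, real_inner_comm, hyω, norm_smul, hω1]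
      simp
    rw [hx] at h; linarith
  -- The part y of x orthogonal to ω can be exchanged with ‖y‖ v by an element of the stabilizer of
  -- ω; invariance of Haar measure then replaces x by tω + ‖y‖ v.
  set w := ‖y‖ • v with hw
  have hwn : ‖w‖ = ‖y‖ := by rw [hw, norm_smul, hv1]; simp
  have hwy : inner ℝ (w - y) ω = 0 := by
    rw [inner_sub_left, hyω, hw, inner_smul_left, hvω]; simp
  let s : stab ω := ⟨swap w y, swap_apply_of_inner_eq_zero hwy⟩
  have hs : (s : Orth n).1 (t • ω + w) = x := by
    rw [map_add, map_smul, mem_stab.1 s.2, hxy]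
    exact congrArg _ (swap_apply_left hwn)
  have hsx : ((s : Orth n)⁻¹ : Orth n).1 x = t • ω + w := by rw [← hs, inv_apply_self]
  rw [← integral_mul_left_eq_self _ s]
  refine integral_congr_ae (ae_of_all _ fun r => ?_)
  have hrω : ((r : Orth n)⁻¹ : Orth n).1 ω = ω := mem_stab.1 ((stab ω).inv_mem r.2)
  have h1 : (((s * r : stab ω) : Orth n)⁻¹ : Orth n).1 x =
      t • ω + ‖y‖ • ((r : Orth n)⁻¹ : Orth n).1 v := by
    rw [Subgroup.coe_mul, mul_inv_rev]
    change ((r : Orth n)⁻¹ : Orth n).1 (((s : Orth n)⁻¹ : Orth n).1 x) = _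
    rw [hsx, hw, map_add, map_smul, map_smul, hrω]
  have hP : ξ.1.starProjection ω = ω := Submodule.starProjection_eq_self_iff.2 hω
  -- The cross term vanishes: r fixes ω, so r⁻¹v stays orthogonal to ω, and projecting onto ξ ∋ ω
  -- does not change this inner product.
  have h2 : inner ℝ ω (ξ.1.starProjection (((r : Orth n)⁻¹ : Orth n).1 v)) = 0 := by
    rw [← Submodule.inner_starProjection_left_eq_right, hP, real_inner_comm, inner_inv_apply,
      mem_stab.1 r.2, hvω]
  change (‖ξ.1.starProjection ((((s * r : stab ω) : Orth n)⁻¹ : Orth n).1 x)‖ ^ 2) ^ m = _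
  rw [h1, map_add, map_smul, map_smul, hP, norm_add_sq_real, inner_smul_left, inner_smul_right, h2,
    norm_smul, norm_smul, hω1, mul_pow ‖‖y‖‖, norm_norm, hyn]
  simp

theorem continuous_norm_starProjection_inv (ξ : Gr n k) (x : E n) :
    Continuous fun r : Orth n => ‖ξ.1.starProjection ((r⁻¹ : Orth n).1 x)‖ :=
  (ξ.1.starProjection.continuous.comp
    ((continuous_subtype_val.comp continuous_inv).clm_apply continuous_const)).norm

/-! ### Vanishing of the moments -/

/-- The moments of an integrable function with vanishing transform in a given direction, by
recursion on the degree. -/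
theorem integral_act_mul_inner_pow_eq_zero [NeZero n] {h : Sph n → ℝ}
    (hh : Integrable h (surf (E n))) (ξ : Gr n k) (hkn : k < n)
    (h0 : ∀ᵐ γ ∂orthHaar n, ∫ θ, h (act γ (incl ξ.1 θ)) ∂surf ξ.1 = 0)
    (ω : sphere (0 : ξ.1) 1) {a : E n} (ha : ‖a‖ = 1) (m : ℕ) :
    ∫ γ, h (act γ (incl ξ.1 ω)) * (inner ℝ a (act γ (incl ξ.1 ω) : E n) ^ 2) ^ m ∂orthHaar n
      = 0 := by
  have hk : 0 < k := by
    rw [← ξ.2, Module.finrank_pos_iff]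
    exact ⟨⟨ω, 0, fun h => by simpa [h] using mem_sphere_zero_iff_norm.1 ω.2⟩⟩
  have hω : ((ω : ξ.1) : E n) ∈ ξ.1 := (ω : ξ.1).2
  have hω1 : ‖((ω : ξ.1) : E n)‖ = 1 := mem_sphere_zero_iff_norm.1 (incl ξ.1 ω).2
  obtain ⟨v, hv, hv1⟩ : ∃ v ∈ ξ.1ᗮ, ‖v‖ = 1 := by
    have h1 := ξ.1.finrank_add_finrank_orthogonal
    rw [ξ.2, finrank_euclideanSpace_fin] at h1
    have : Nontrivial ξ.1ᗮ := Module.nontrivial_of_finrank_pos (R := ℝ) (by omega)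
    obtain ⟨v, hv⟩ := exists_norm_eq (ξ.1ᗮ : Submodule ℝ (E n)) zero_le_one
    exact ⟨v, v.2, hv⟩
  set M : ℕ → ℝ := fun j => ∫ γ, h (act γ (incl ξ.1 ω)) *
    (inner ℝ a (act γ (incl ξ.1 ω) : E n) ^ 2) ^ j ∂orthHaar n with hM
  set B : stab ((ω : ξ.1) : E n) → ℝ := fun r =>
    ‖ξ.1.starProjection (((r : Orth n)⁻¹ : Orth n).1 v)‖ ^ 2 with hB
  have hBc : Continuous B :=
    ((continuous_norm_starProjection_inv ξ v).comp continuous_subtype_val).pow 2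
  have hB1 : ∀ r, B r ≤ 1 := fun r => by
    refine pow_le_one₀ (norm_nonneg _) ?_
    refine (ξ.1.norm_starProjection_apply_le _).trans ?_
    rw [norm_apply, hv1]
  set c : ℕ → ℕ → ℝ := fun m j => ∫ r, (1 - B r) ^ j * B r ^ (m - j) * (m.choose j : ℝ)
    ∂stabHaar ((ω : ξ.1) : E n) with hc
  -- The leading coefficient is the mean of the continuous nonnegative function (1 - B)^m, which
  -- equals 1 at the identity because v is orthogonal to ξ.
  have hcm : ∀ m, c m m ≠ 0 := fun m => by
    have h1 : 0 < ∫ r, (1 - B r) ^ m ∂stabHaar ((ω : ξ.1) : E n) := by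
      refine Continuous.integral_pos_of_hasCompactSupport_nonneg_nonzero (x := 1)
        ((continuous_const.sub hBc).pow m) (HasCompactSupport.of_compactSpace _)
        (fun r => pow_nonneg (sub_nonneg.2 (hB1 r)) m) ?_
      have : B 1 = 0 := by
        have h2 : (((1 : stab ((ω : ξ.1) : E n)) : Orth n)⁻¹ : Orth n).1 v = v := by
          rw [Subgroup.coe_one, inv_one]; rfl
        simp only [hB, h2]
        rw [(ξ.1.starProjection_apply_eq_zero_iff).2 hv]; simp
      simp [this]
    simpa [hc] using h1.ne'
  have hint : ∀ j, Integrable (fun γ => h (act γ (incl ξ.1 ω)) *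
      (inner ℝ a (act γ (incl ξ.1 ω) : E n) ^ 2) ^ j) (orthHaar n) := fun j =>
    integrable_act_mul hh _ (((continuous_const.inner (continuous_subtype_val.comp
      (continuous_act.comp (Continuous.prodMk_left _)))).pow 2).pow j)
  -- Translating γ by r in the stabilizer of ω does not move γω, so the weight F may be averaged
  -- over r. With s = ⟨a, γω⟩², the average is the mean of (s(1 - B) + B)^m, expanded by the
  -- binomial theorem.
  have hrec : ∀ m, ∑ j ∈ Finset.range (m + 1), c m j * M j = 0 := fun m => by
    set F : Orth n → ℝ := fun γ => (‖ξ.1.starProjection ((γ⁻¹ : Orth n).1 a)‖ ^ 2) ^ m with hF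
    have hFc : Continuous F := ((continuous_norm_starProjection_inv ξ a).pow 2).pow m
    have h1 : ∫ γ, h (act γ (incl ξ.1 ω)) * F γ ∂orthHaar n = 0 := by
      refine integral_act_mul_eq_zero hh ξ hk h0 hFc (fun γ r hr => ?_) ω
      have : ((γ * r)⁻¹ : Orth n).1 a = (r⁻¹ : Orth n).1 ((γ⁻¹ : Orth n).1 a) := by
        rw [mul_inv_rev]; rfl
      simp only [hF]
      rw [this, norm_starProjection_inv_apply hr]
    have h2 : ∀ r : stab ((ω : ξ.1) : E n),
        ∫ γ, h (act γ (incl ξ.1 ω)) * F (γ * r) ∂orthHaar n = 0 := fun r => by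
      rw [← h1, ← integral_mul_right_eq_self (fun γ => h (act γ (incl ξ.1 ω)) * F γ) (r : Orth n)]
      refine integral_congr_ae (ae_of_all _ fun γ => ?_)
      have hr : act (γ * (r : Orth n)) (incl ξ.1 ω) = act γ (incl ξ.1 ω) :=
        congrArg (act γ) (Subtype.ext (a1 := act (r : Orth n) (incl ξ.1 ω)) (mem_stab.1 r.2))
      exact congrArg₂ (· * ·) (congrArg h hr.symm) rfl
    have hcont : Continuous fun p : Orth n × stab ((ω : ξ.1) : E n) => F (p.1 * p.2) :=
      hFc.comp (continuous_fst.mul (continuous_subtype_val.comp continuous_snd))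
    obtain ⟨C, hC⟩ := (isCompact_range hcont).isBounded.exists_norm_le
    have h3 := integral_integral_swap
      (f := fun γ (r : stab ((ω : ξ.1) : E n)) => h (act γ (incl ξ.1 ω)) * F (γ * r))
      (μ := orthHaar n) (ν := stabHaar ((ω : ξ.1) : E n))
      (((integrable_act hh (incl ξ.1 ω)).comp_fst _).mul_bdd hcont.aestronglyMeasurable
        (ae_of_all _ fun p => hC _ ⟨p, rfl⟩))
    rw [integral_congr_ae (ae_of_all _ h2), integral_zero] at h3
    rw [← h3]
    have h4 : ∀ γ : Orth n, ∫ r : stab ((ω : ξ.1) : E n), h (act γ (incl ξ.1 ω)) * F (γ * r)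
        ∂stabHaar ((ω : ξ.1) : E n) = ∑ j ∈ Finset.range (m + 1), c m j *
        (h (act γ (incl ξ.1 ω)) * (inner ℝ a (act γ (incl ξ.1 ω) : E n) ^ 2) ^ j) := fun γ => by
      have h5 := integral_stab_norm_starProjection ξ hω hω1 hv hv1
        (x := (γ⁻¹ : Orth n).1 a) (by rw [norm_apply, ha]) m
      have h6 : (inner ℝ ((γ⁻¹ : Orth n).1 a) ((ω : ξ.1) : E n) : ℝ) =
          inner ℝ a (act γ (incl ξ.1 ω) : E n) := inner_inv_apply _ _ _
      rw [h6] at h5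
      have h7 : ∀ r : stab ((ω : ξ.1) : E n), F (γ * r) =
          (‖ξ.1.starProjection (((r : Orth n)⁻¹ : Orth n).1 ((γ⁻¹ : Orth n).1 a))‖ ^ 2) ^ m :=
        fun r => by
          simp only [hF]
          rw [mul_inv_rev]; rfl
      rw [integral_const_mul, integral_congr_ae (ae_of_all _ h7), h5]
      have h8 : ∀ r : stab ((ω : ξ.1) : E n), (inner ℝ a (act γ (incl ξ.1 ω) : E n) ^ 2 +
          (1 - inner ℝ a (act γ (incl ξ.1 ω) : E n) ^ 2) * B r) ^ m =
          ∑ j ∈ Finset.range (m + 1), (inner ℝ a (act γ (incl ξ.1 ω) : E n) ^ 2) ^ j *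
            ((1 - B r) ^ j * B r ^ (m - j) * (m.choose j : ℝ)) := fun r => by
        have : ∀ s b : ℝ, s + (1 - s) * b = s * (1 - b) + b := fun s b => by ring
        rw [this, add_pow]
        exact Finset.sum_congr rfl fun j _ => by rw [mul_pow]; ring
      rw [integral_congr_ae (ae_of_all _ h8), integral_finsetSum, Finset.mul_sum]
      · refine Finset.sum_congr rfl fun j _ => ?_
        rw [integral_const_mul]
        ring
      · intro j _
        refine Continuous.integrable_of_hasCompactSupport ?_ (HasCompactSupport.of_compactSpace _)
        fun_prop
    rw [integral_congr_ae (ae_of_all _ h4), integral_finsetSum _ fun j _ => (hint j).const_mul _]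
    exact Finset.sum_congr rfl fun j _ => (integral_const_mul _ _).symm
  change M m = 0
  induction m using Nat.strong_induction_on with
  | _ m ih =>
    have h1 := hrec m
    rw [Finset.sum_range_succ, Finset.sum_eq_zero fun j hj => by
      rw [ih j (Finset.mem_range.1 hj), mul_zero], zero_add] at h1
    exact (mul_eq_zero.1 h1).resolve_left (hcm m)

/-! ### Functions on the sphere determined by their moments -/

theorem integrable_mul_inner_pow {σ : Measure (Sph n)} {h : Sph n → ℝ} (hh : Integrable h σ)
    (a : E n) (m : ℕ) : Integrable (fun θ => h θ * inner ℝ (θ : E n) a ^ m) σ := by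
  refine hh.mul_bdd (c := ‖a‖ ^ m) ?_ (ae_of_all _ fun θ => ?_)
  · exact ((continuous_subtype_val.inner continuous_const).pow m).aestronglyMeasurable
  · rw [norm_pow]
    refine pow_le_pow_left₀ (norm_nonneg _) ((norm_inner_le_norm _ _).trans ?_) m
    simp

/-- An integrable function on the sphere all of whose moments vanish has vanishing Fourier
transform. -/
theorem integral_mul_cexp_eq_zero {σ : Measure (Sph n)} {h : Sph n → ℝ} (hh : Integrable h σ)
    (h0 : ∀ (a : E n) (m : ℕ), ∫ θ, h θ * inner ℝ (θ : E n) a ^ m ∂σ = 0) (a : E n) :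
    ∫ θ, (h θ : ℂ) * Complex.exp ((inner ℝ (θ : E n) a : ℝ) * Complex.I) ∂σ = 0 := by
  set F : ℕ → Sph n → ℂ := fun m θ =>
    ((h θ * inner ℝ (θ : E n) a ^ m : ℝ) : ℂ) * (Complex.I ^ m / (m.factorial : ℂ)) with hF
  have hFi : ∀ m, Integrable (F m) σ := fun m =>
    (integrable_mul_inner_pow hh a m).ofReal.mul_const _
  -- On the unit sphere |⟨θ, a⟩| ≤ ‖a‖, so the exponential series of ‖a‖ dominates and permits
  -- termwise integration.
  have hsum : Summable fun m => ∫ θ, ‖F m θ‖ ∂σ := by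
    refine Summable.of_nonneg_of_le (fun m => integral_nonneg fun θ => norm_nonneg _) (fun m => ?_)
      ((Real.summable_pow_div_factorial ‖a‖).mul_left (∫ θ, ‖h θ‖ ∂σ))
    rw [← integral_mul_const]
    refine integral_mono (hFi m).norm (hh.norm.mul_const _) fun θ => ?_
    have hle : ‖(inner ℝ (θ : E n) a : ℝ)‖ ^ m ≤ ‖a‖ ^ m :=
      pow_le_pow_left₀ (norm_nonneg _) ((norm_inner_le_norm _ _).trans (by simp)) m
    simp only [hF]
    rw [norm_mul, norm_div, norm_pow, Complex.norm_I, one_pow, Complex.norm_natCast,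
      Complex.norm_real, norm_mul, norm_pow, mul_assoc, mul_one_div]
    gcongr
  have hS := hasSum_integral_of_summable_integral_norm hFi hsum
  have h1 : ∀ m, ∫ θ, F m θ ∂σ = 0 := fun m => by
    simp only [hF]
    rw [integral_mul_const, integral_complex_ofReal, h0]; simp
  simp only [h1] at hS
  rw [← hS.unique hasSum_zero]
  refine integral_congr_ae (ae_of_all _ fun θ => ?_)
  have h2 : HasSum (fun m => F m θ)
      ((h θ : ℂ) * Complex.exp ((inner ℝ (θ : E n) a : ℝ) * Complex.I)) := by
    have h3 := (NormedSpace.expSeries_div_hasSum_exp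
      (((inner ℝ (θ : E n) a : ℝ) : ℂ) * Complex.I)).mul_left (h θ : ℂ)
    rw [← Complex.exp_eq_exp_ℂ] at h3
    refine h3.congr_fun fun m => ?_
    simp only [hF]
    push_cast
    ring
  exact h2.tsum_eq.symm

theorem charFun_map_withDensity {σ : Measure (Sph n)} {h : Sph n → ℝ}
    (hh : Integrable h σ) (a : E n) :
    charFun ((σ.withDensity fun θ => ENNReal.ofReal (h θ)).map ((↑) : Sph n → E n)) a =
      ∫ θ, ((max (h θ) 0 : ℝ) : ℂ) * Complex.exp ((inner ℝ (θ : E n) a : ℝ) * Complex.I) ∂σ := by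
  rw [charFun_apply, integral_map continuous_subtype_val.aemeasurable (by fun_prop)]
  rw [show (fun θ => ENNReal.ofReal (h θ)) = fun θ => ((h θ).toNNReal : ℝ≥0∞) from rfl,
    integral_withDensity_eq_integral_smul₀ hh.1.aemeasurable.real_toNNReal]
  refine integral_congr_ae (ae_of_all _ fun θ => ?_)
  simp [NNReal.smul_def, Real.coe_toNNReal']

/-- The positive and negative parts of h are densities of two finite measures whose characteristic
functions differ by the Fourier transform of h, which is zero. The measures agree, hence so do the
densities; having disjoint supports, both vanish. -/
theorem ae_eq_zero_of_forall_moment_eq_zero {σ : Measure (Sph n)} [IsFiniteMeasure σ]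
    {h : Sph n → ℝ} (hh : Integrable h σ)
    (h0 : ∀ (a : E n) (m : ℕ), ∫ θ, h θ * inner ℝ (θ : E n) a ^ m ∂σ = 0) :
    h =ᵐ[σ] 0 := by
  have hfin : ∀ {u : Sph n → ℝ}, Integrable u σ →
      IsFiniteMeasure (σ.withDensity fun θ => ENNReal.ofReal (u θ)) := fun hu =>
    isFiniteMeasure_withDensity_ofReal hu.2
  have := hfin hh
  have := hfin hh.neg
  have hi : ∀ {u : Sph n → ℝ}, Integrable u σ → ∀ a : E n, Integrable (fun θ => ((u θ : ℝ) : ℂ) *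
      Complex.exp ((inner ℝ (θ : E n) a : ℝ) * Complex.I)) σ := fun hu a => by
    refine hu.ofReal.mul_bdd (c := 1) (Continuous.aestronglyMeasurable (by fun_prop))
      (ae_of_all _ fun θ => (Complex.norm_exp_ofReal_mul_I _).le)
  have h1 : (σ.withDensity fun θ => ENNReal.ofReal (h θ)).map ((↑) : Sph n → E n) =
      (σ.withDensity fun θ => ENNReal.ofReal ((-h) θ)).map ((↑) : Sph n → E n) := by
    refine Measure.ext_of_charFun (funext fun a => ?_)
    rw [charFun_map_withDensity hh, charFun_map_withDensity hh.neg, ← sub_eq_zero,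
      ← integral_sub (hi hh.pos_part a) (hi hh.neg.pos_part a), ← integral_mul_cexp_eq_zero hh h0 a]
    refine integral_congr_ae (ae_of_all _ fun θ => ?_)
    simp only [Pi.neg_apply]
    rw [← sub_mul, ← Complex.ofReal_sub, max_zero_sub_eq_self]
  have he : MeasurableEmbedding ((↑) : Sph n → E n) :=
    MeasurableEmbedding.subtype_coe isClosed_sphere.measurableSet
  have h2 := he.comap_map (σ.withDensity fun θ => ENNReal.ofReal (h θ))
  rw [h1, he.comap_map, withDensity_eq_iff_of_sigmaFinite hh.neg.1.aemeasurable.ennreal_ofReal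
    hh.1.aemeasurable.ennreal_ofReal] at h2
  filter_upwards [h2] with θ hθ
  rcases le_total (h θ) 0 with hle | hle
  · rw [ENNReal.ofReal_of_nonpos hle, ENNReal.ofReal_eq_zero] at hθ
    exact le_antisymm hle (by simpa using hθ)
  · have h4 : ENNReal.ofReal ((-h) θ) = 0 := ENNReal.ofReal_of_nonpos (by simpa using hle)
    rw [h4, eq_comm, ENNReal.ofReal_eq_zero] at hθ
    exact le_antisymm hθ hle

/-! ### Injectivity of the transform -/

/-- Injectivity of the transform on real even integrable functions. -/
theorem ae_eq_zero_of_funk_eq_zero {h : Sph n → ℝ} (hh : EvenL1 h) (hk : 0 < k) (hkn : k < n)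
    (h0 : ∀ᵐ ξ ∂grMeasure hkn.le, funk h ξ = 0) : h =ᵐ[surf (E n)] 0 := by
  have : NeZero n := ⟨by omega⟩
  set ξ : Gr n k := coordSubspace hkn.le with hξ
  have : Nontrivial ξ.1 := Module.nontrivial_of_finrank_pos (R := ℝ) (by rw [ξ.2]; exact hk)
  obtain ⟨ω, hω⟩ := (NormedSpace.sphere_nonempty (x := (0 : ξ.1)) (r := 1)).2 zero_le_one
  have h1 : ∀ᵐ γ ∂orthHaar n, ∫ θ, h (act γ (incl ξ.1 θ)) ∂surf ξ.1 = 0 := by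
    filter_upwards [ae_of_ae_map (measurable_rotate _).aemeasurable h0] with γ hγ
    rw [← integral_rotate]; exact hγ
  have heven : ∀ (a : E n) (m : ℕ), ‖a‖ = 1 →
      ∫ θ, h θ * inner ℝ (θ : E n) a ^ (2 * m) ∂surf (E n) = 0 := fun a m ha => by
    rw [integral_act (integrable_mul_inner_pow hh.1 a _).1 (incl ξ.1 ⟨ω, hω⟩),
      ← mul_zero ((surf (E n)).real Set.univ)]
    congr 1
    rw [← integral_act_mul_inner_pow_eq_zero hh.1 ξ hkn h1 ⟨ω, hω⟩ ha m]
    refine integral_congr_ae (ae_of_all _ fun γ => ?_)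
    simp only [pow_mul, real_inner_comm a]
  have hodd : ∀ (a : E n) (m : ℕ), Odd m →
      ∫ θ, h θ * inner ℝ (θ : E n) a ^ m ∂surf (E n) = 0 := fun a m hm => by
    have h2 := (measurePreserving_neg (V := E n)).integral_comp
      (MeasurableEquiv.neg _).measurableEmbedding (fun θ => h θ * inner ℝ (θ : E n) a ^ m)
    have h3 : ∫ θ : Sph n, h (-θ) * inner ℝ ((-θ : Sph n) : E n) a ^ m ∂surf (E n) =
        -∫ θ, h θ * inner ℝ (θ : E n) a ^ m ∂surf (E n) := by
      rw [← integral_neg]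
      refine integral_congr_ae ?_
      filter_upwards [hh.2] with θ hθ
      simp only [hθ, coe_neg_sphere, inner_neg_left, hm.neg_pow, mul_neg]
    linarith
  refine ae_eq_zero_of_forall_moment_eq_zero hh.1 fun a m => ?_
  rcases Nat.even_or_odd m with hm | hm
  · obtain ⟨j, rfl⟩ := hm.two_dvd
    rcases eq_or_ne a 0 with rfl | ha
    · rcases Nat.eq_zero_or_pos j with rfl | hj
      -- For a = 0 and degree 0 the moment is ∫ h, which is also the degree 0 moment in any unit
      -- direction b.
      · obtain ⟨b, hb⟩ := exists_norm_eq (E n) zero_le_one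
        simpa using heven b 0 hb
      · simp [hj.ne']
    · have h2 := heven (‖a‖⁻¹ • a) j (norm_smul_inv_norm ha)
      simp_rw [inner_smul_right, mul_pow, mul_left_comm (h _)] at h2
      rw [integral_const_mul] at h2
      exact (mul_eq_zero.1 h2).resolve_left (by simp [ha])
  · exact hodd a m hm

variable {𝕜 : Type*} [RCLike 𝕜]

/-- Injectivity of the transform on even integrable functions. -/
theorem EvenL1.ae_eq_of_funk_ae_eq {g g' : Sph n → 𝕜} (hg : EvenL1 g) (hg' : EvenL1 g')
    (hk : 0 < k) (hkn : k < n) (h : ∀ᵐ ξ : Gr n k ∂grMeasure hkn.le, funk g ξ = funk g' ξ) :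
    g =ᵐ[surf (E n)] g' := by
  have : NeZero n := ⟨by omega⟩
  have hsub : ∀ᵐ ξ : Gr n k ∂grMeasure hkn.le,
      Integrable (fun θ => g (incl ξ.1 θ) - g' (incl ξ.1 θ)) (surf ξ.1) ∧
        ∫ θ, (g (incl ξ.1 θ) - g' (incl ξ.1 θ)) ∂surf ξ.1 = 0 := by
    filter_upwards [h, ae_integrable_incl hkn.le hg.1, ae_integrable_incl hkn.le hg'.1]
      with ξ h1 h2 h3
    exact ⟨h2.sub h3, (integral_sub h2 h3).trans (sub_eq_zero.2 h1)⟩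
  have hre : (fun θ => RCLike.re (g θ - g' θ)) =ᵐ[surf (E n)] 0 := by
    refine ae_eq_zero_of_funk_eq_zero (k := k) ⟨(hg.1.sub hg'.1).re, ?_⟩ hk hkn ?_
    · filter_upwards [hg.2, hg'.2] with θ h1 h2
      rw [h1, h2]
    · filter_upwards [hsub] with ξ hξ
      exact (integral_re hξ.1).trans (by rw [hξ.2, map_zero])
  have him : (fun θ => RCLike.im (g θ - g' θ)) =ᵐ[surf (E n)] 0 := by
    refine ae_eq_zero_of_funk_eq_zero (k := k) ⟨(hg.1.sub hg'.1).im, ?_⟩ hk hkn ?_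
    · filter_upwards [hg.2, hg'.2] with θ h1 h2
      rw [h1, h2]
    · filter_upwards [hsub] with ξ hξ
      exact (integral_im hξ.1).trans (by rw [hξ.2, map_zero])
  filter_upwards [hre, him] with θ h1 h2
  exact sub_eq_zero.1 (RCLike.ext (by simpa using h1) (by simpa using h2))

/-- Injectivity makes the choice in `funkInv` immaterial up to null sets. -/
theorem IsFunkPreimage.funkInv_ae_eq {φ : Gr n k → 𝕜} {g : Sph n → 𝕜} (hk : 0 < k) (hkn : k < n)
    (hg : IsFunkPreimage hkn.le φ g) : funkInv hkn.le φ =ᵐ[surf (E n)] g := by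
  have h : ∃ g, IsFunkPreimage hkn.le φ g := ⟨g, hg⟩
  rw [funkInv, dif_pos h]
  refine h.choose_spec.1.ae_eq_of_funk_ae_eq hg.1 hk hkn ?_
  filter_upwards [h.choose_spec.2, hg.2] with ξ h1 h2
  rw [h1, h2]

/-! ### Recovery from the hemispherical transforms -/

/-- Half of the even extension of the restriction of `f` to a set `s`. -/
def evenPart (s : Set (Sph n)) (f : Sph n → 𝕜) (θ : Sph n) : 𝕜 :=
  2⁻¹ * (s.indicator f θ + s.indicator f (-θ))

theorem evenL1_evenPart {s : Set (Sph n)} (hs : MeasurableSet s) {f : Sph n → 𝕜}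
    (hf : Integrable f (surf (E n))) : EvenL1 (evenPart s f) := by
  refine ⟨?_, ae_of_all _ fun θ => ?_⟩
  · exact ((hf.indicator hs).add
      (measurePreserving_neg.integrable_comp_of_integrable (hf.indicator hs))).const_mul _
  · simp only [evenPart, neg_neg, add_comm]

/-- The antipodal map preserves the measure on S^{n-1} ∩ ξ, so both summands of `evenPart`
contribute equally and the factor 1/2 cancels. -/
theorem funk_evenPart {s : Set (Sph n)} (hs : MeasurableSet s) {f : Sph n → 𝕜} {ξ : Gr n k}
    (hf : Integrable (fun θ => f (incl ξ.1 θ)) (surf ξ.1)) :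
    funk (evenPart s f) ξ = ∫ θ in incl ξ.1 ⁻¹' s, f (incl ξ.1 θ) ∂surf ξ.1 := by
  have hs' : MeasurableSet (incl ξ.1 ⁻¹' s) := (continuous_incl ξ.1).measurable hs
  have h1 : Integrable (fun θ => s.indicator f (incl ξ.1 θ)) (surf ξ.1) := hf.indicator hs'
  have h2 : Integrable (fun θ => s.indicator f (incl ξ.1 (-θ))) (surf ξ.1) :=
    measurePreserving_neg.integrable_comp_of_integrable h1
  have h3 : ∫ θ, s.indicator f (incl ξ.1 (-θ)) ∂surf ξ.1 =
      ∫ θ, s.indicator f (incl ξ.1 θ) ∂surf ξ.1 :=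
    measurePreserving_neg.integral_comp (MeasurableEquiv.neg _).measurableEmbedding
      fun θ => s.indicator f (incl ξ.1 θ)
  have h4 : funk (evenPart s f) ξ = ∫ θ, 2⁻¹ * (s.indicator f (incl ξ.1 θ) +
      s.indicator f (incl ξ.1 (-θ))) ∂surf ξ.1 := rfl
  rw [h4, integral_const_mul, integral_add h1 h2, h3, ← two_mul, ← mul_assoc,
    inv_mul_cancel₀ two_ne_zero, one_mul, ← integral_indicator hs']
  rfl

theorem isFunkPreimage_evenPart {s : Set (Sph n)} (hs : MeasurableSet s) (hn : 0 < n) (hkn : k ≤ n)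
    {f : Sph n → 𝕜} (hf : Integrable f (surf (E n))) {φ : Gr n k → 𝕜}
    (hφ : ∀ᵐ ξ ∂grMeasure hkn, φ ξ = ∫ θ in incl ξ.1 ⁻¹' s, f (incl ξ.1 θ) ∂surf ξ.1) :
    IsFunkPreimage hkn φ (evenPart s f) := by
  have : NeZero n := ⟨hn.ne'⟩
  refine ⟨evenL1_evenPart hs hf, ?_⟩
  filter_upwards [hφ, ae_integrable_incl hkn hf] with ξ h1 h2
  rw [h1, funk_evenPart hs h2]

theorem two_mul_evenPart {s : Set (Sph n)} {f : Sph n → 𝕜} {θ : Sph n} (h : θ ∈ s) (h' : -θ ∉ s) :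
    2 * evenPart s f θ = f θ := by
  simp [evenPart, h, h']

theorem continuous_lastCoord : Continuous (lastCoord : E n → ℝ) := by
  unfold lastCoord
  split_ifs <;> fun_prop

theorem lastCoord_neg (x : E n) : lastCoord (-x) = -lastCoord x := by
  unfold lastCoord
  split_ifs <;> simp

theorem measurableSet_upper : MeasurableSet {θ : Sph n | 0 < lastCoord (θ : E n)} :=
  (isOpen_lt continuous_const (continuous_lastCoord.comp continuous_subtype_val)).measurableSet

theorem measurableSet_lower : MeasurableSet {θ : Sph n | lastCoord (θ : E n) < 0} :=
  (isOpen_lt (continuous_lastCoord.comp continuous_subtype_val) continuous_const).measurableSet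

end HemiFunk

end

/-- The first part says that `F_k` is invertible on even integrable functions, with inverse
`funkInv`. The second part is the recovery of `f ∈ L¹(S^{n-1})` from `φ⁺ = F_k^+ f` and
`φ⁻ = F_k^- f` (given almost everywhere on `G_{n,k}`): the defining integrals converge absolutely,
`φ^±` lie in the range of `F_k` on even integrable functions, and
`f = 2 F_k⁻¹ φ^±` almost everywhere on `S^{n-1}_±`. -/
theorem theorem2p1 {𝕜 : Type*} [RCLike 𝕜] (n k : ℕ) (hk : 2 ≤ k) (hkn : k < n) :
    (∀ g : HemiFunk.Sph n → 𝕜, HemiFunk.EvenL1 g →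
      ∀ᵐ θ ∂HemiFunk.surf (HemiFunk.E n),
        HemiFunk.funkInv hkn.le (HemiFunk.funk g) θ = g θ) ∧
    ∀ f : HemiFunk.Sph n → 𝕜, Integrable f (HemiFunk.surf (HemiFunk.E n)) →
      (∀ᵐ ξ ∂HemiFunk.grMeasure hkn.le,
        IntegrableOn (fun θ => f (HemiFunk.incl ξ.1 θ)) (HemiFunk.upper ξ) (HemiFunk.surf ξ.1) ∧
        IntegrableOn (fun θ => f (HemiFunk.incl ξ.1 θ)) (HemiFunk.lower ξ) (HemiFunk.surf ξ.1)) ∧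
      ∀ φp φm : HemiFunk.Gr n k → 𝕜,
        (∀ᵐ ξ ∂HemiFunk.grMeasure hkn.le, φp ξ = HemiFunk.funkPlus f ξ) →
        (∀ᵐ ξ ∂HemiFunk.grMeasure hkn.le, φm ξ = HemiFunk.funkMinus f ξ) →
        (∃ g, HemiFunk.IsFunkPreimage hkn.le φp g) ∧
        (∃ g, HemiFunk.IsFunkPreimage hkn.le φm g) ∧
        ∀ᵐ θ : HemiFunk.Sph n ∂HemiFunk.surf (HemiFunk.E n),
          (0 < HemiFunk.lastCoord (θ : HemiFunk.E n) →
            f θ = 2 * HemiFunk.funkInv hkn.le φp θ) ∧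
          (HemiFunk.lastCoord (θ : HemiFunk.E n) < 0 →
            f θ = 2 * HemiFunk.funkInv hkn.le φm θ) := by
  have hk0 : 0 < k := by omega
  have hn : 0 < n := by omega
  have : NeZero n := ⟨hn.ne'⟩
  refine ⟨fun g hg => HemiFunk.IsFunkPreimage.funkInv_ae_eq hk0 hkn ⟨hg, ae_of_all _ fun _ => rfl⟩,
    fun f hf => ⟨?_, fun φp φm hp hm => ?_⟩⟩
  · filter_upwards [HemiFunk.ae_integrable_incl hkn.le hf] with ξ hξ
    exact ⟨hξ.integrableOn, hξ.integrableOn⟩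
  · have h1 := HemiFunk.isFunkPreimage_evenPart HemiFunk.measurableSet_upper hn hkn.le hf hp
    have h2 := HemiFunk.isFunkPreimage_evenPart HemiFunk.measurableSet_lower hn hkn.le hf hm
    refine ⟨⟨_, h1⟩, ⟨_, h2⟩, ?_⟩
    filter_upwards [h1.funkInv_ae_eq hk0 hkn, h2.funkInv_ae_eq hk0 hkn] with θ h3 h4
    refine ⟨fun hθ => ?_, fun hθ => ?_⟩
    · rw [h3, HemiFunk.two_mul_evenPart]
      · exact hθ
      · simpa [HemiFunk.lastCoord_neg] using hθ.le
    · rw [h4, HemiFunk.two_mul_evenPart]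
      · exact hθ
      · simpa [HemiFunk.lastCoord_neg] using hθ.le
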